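/- **Setting.** Let $X$ be a complex Hilbert space and $Z\subset X$ a linear subspace that is a Hilbert space with its own norm. Let $p,n_{d,1},n_{d,3}\in\mathbb N_0$ and let $\mathfrak A_0\in\mathcal L(Z,X)$, $\mathfrak B\in\mathcal L(Z,\mathbb C^p)$, $B_d\in\mathcal L(\mathbb C^{n_{d,1}},X)$, $\mathfrak B_d\in\mathcal L(Z,\mathbb C^{n_{d,3}})$, $\mathfrak C\in\mathcal L(Z,\mathbb C^p)$. Put $\mathfrak A=\mathfrak A_0|_{D(\mathfrak A)}$ with $D(\mathfrak A)=\ker\mathfrak B_d$, and $A=\mathfrak A_0|_{D(A)}$ with $D(A)=\ker\mathfrak B\cap\ker\mathfrak B_d$, both regarded as unbounded operators on $X$. Assume that - $A$ generates a strongly continuous contraction semigroup on $X$; - $\begin{pmatrix}\mathfrak B\\ \mathfrak B_d\end{pmatrix}:Z\to\mathbb C^{p+n_{d,3}}$ is surjective; - $\operatorname{Re}\langle\mathfrak A x,x\rangle_X\le\operatorname{Re}\langle\mathfrak Bx,\mathfrak Cx\rangle_{\mathbb C^p}$ for all $x\in D(\mathfrak A)$. For $\lambda\in\rho(A)$ the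 transfer function $P(\lambda)\in\mathcal L(\mathbb C^p)$ is defined by $P(\lambda)u=\mathfrak Cx$, where $x\in D(\mathfrak A)$ is the unique solution of $(\lambda-\mathfrak A)x=0$, $\mathfrak Bx=u$. For a bounded operator $T$ on a Hilbert space, $\operatorname{Re}T=\frac12(T+T^*)$, and $T>0$ means that $T-\varepsilon I\ge0$ for some $\varepsilon>0$. Let $q\in\mathbb N_0$ and $0=\omega_0<\omega_1<\dots<\omega_q$. On $X_c=\mathbb C^{p(2q+1)}$ let $$J_c=\operatorname{blkdiag}(J_c^0,J_c^1,\dots,J_c^q),\quad J_c^0=0_p,\quad J_c^k=\begin{pmatrix}0&\omega_kI_p\\-\omega_kI_p&0\end{pmatrix}\ (1\le k\le q),$$ $$B_c=\begin{pmatrix}B_c^0\\\vdots\\B_c^q\end{pmatrix}\in\mathcal L(\mathbb C^p,X_c),\quad B_c^0=I_p,\quad B_c^k=\begin{pmatrix}I_p\\0\end{pmatrix}\ (1\le k\le q).$$ **Lemma.** Assume that $\pm i\omega_k\in\rho(A)$ and $\operatorname{Re}P(\pm i\omega_k)>0$ for all $k\in\{0,\dots,q\}$, and that $A$ generates an exponentially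 stable semigroup on $X$. Then there exists $H\in\mathcal L(X_c,X)$ with $\operatorname{ran}(H)\subset Z$ such that $$\operatorname{ran}(H)\subset D(\mathfrak A),\qquad HJ_c=\mathfrak AH,\qquad \mathfrak BH=-B_c^*,$$ and $\mathfrak CH\in\mathcal L(X_c,\mathbb C^p)$. Moreover, for this $H$ there exist constants $\delta_0^*,M_c>0$ such that for every $\delta_c\in(0,\delta_0^*)$ there is $P_{c0}\in\mathcal L(X_c)$ with $P_{c0}>0$, $\|P_{c0}\|\le M_c$ and $$P_{c0}\bigl(J_c+\delta_c^2B_c\mathfrak CH\bigr)+\bigl(J_c+\delta_c^2B_c\mathfrak CH\bigr)^*P_{c0}=-\delta_c^2I.$$ -/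

import Mathlib

open scoped InnerProductSpace NNReal Topology
open Filter

namespace RobustReg

noncomputable section

/-! ### Positivity of bounded operators -/

/-- `T > 0`: there is `ε > 0` with `T - ε I ≥ 0`. -/
def OpPos {E : Type*} [NormedAddCommGroup E] [InnerProductSpace ℂ E]
    (T : E →L[ℂ] E) : Prop :=
  ∃ ε : ℝ, 0 < ε ∧ (T - (ε : ℂ) • ContinuousLinearMap.id ℂ E).IsPositive

/-- `Re T = (T + T*) / 2`. -/
def opRe {E : Type*} [NormedAddCommGroup E] [InnerProductSpace ℂ E] [CompleteSpace E]
    (T : E →L[ℂ] E) : E →L[ℂ] E :=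
  (1 / 2 : ℂ) • (T + ContinuousLinearMap.adjoint T)

/-! ### Unbounded operators: resolvent set and semigroup generation -/

section Operators

variable {X : Type*} [NormedAddCommGroup X] [InnerProductSpace ℂ X]

/-- The resolvent set of an unbounded operator `A`: those `lam` for which
`lam - A : D(A) → X` is a bijection whose inverse `R` is bounded on `X`. -/
def resolventSet (A : X →ₗ.[ℂ] X) : Set ℂ :=
  {lam | ∃ R : X →L[ℂ] X,
    (∀ x : A.domain, R (lam • (x : X) - A x) = x) ∧
    ∀ y : X, ∃ h : R y ∈ A.domain, lam • R y - A ⟨R y, h⟩ = y}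

/-- A strongly continuous semigroup of bounded operators on `X`. -/
structure C0Semigroup (X : Type*) [NormedAddCommGroup X] [InnerProductSpace ℂ X] where
  T : ℝ≥0 → X →L[ℂ] X
  map_zero : T 0 = ContinuousLinearMap.id ℂ X
  map_add : ∀ s t, T (s + t) = (T s).comp (T t)
  tendsto_zero : ∀ x, Tendsto (fun t => T t x) (𝓝[>] 0) (𝓝 x)

/-- `A` is the generator of `S`: `x ∈ D(A)` and `A x = y` precisely when
`(T(t) x - x) / t → y` as `t → 0+`. -/
def Generates (A : X →ₗ.[ℂ] X) (S : C0Semigroup X) : Prop :=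
  ∀ x y : X, (x, y) ∈ A.graph ↔
    Tendsto (fun t : ℝ≥0 => ((t : ℝ) : ℂ)⁻¹ • (S.T t x - x)) (𝓝[>] 0) (𝓝 y)

/-- `‖T(t)‖ ≤ 1` for all `t ≥ 0`. -/
def C0Semigroup.IsContraction (S : C0Semigroup X) : Prop := ∀ t, ‖S.T t‖ ≤ 1

/-- `‖T(t)‖ ≤ M e^{-a t}` for some `M, a > 0` and all `t ≥ 0`. -/
def C0Semigroup.IsExpStable (S : C0Semigroup X) : Prop :=
  ∃ M a : ℝ, 0 < M ∧ 0 < a ∧ ∀ t : ℝ≥0, ‖S.T t‖ ≤ M * Real.exp (-a * t)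

end Operators

/-! ### Boundary control and observation systems -/

/-- The operators of a boundary control and observation system on `X`. The Hilbert space
`Z ⊆ X` is a type with its own Hilbert structure and an injective linear map `emb : Z → X`.
`A0 = 𝔄₀`, `B = 𝔅`, `Bd = 𝔅_d` (boundary disturbance), `C = 𝔠`, and `Bdist = B_d`
(distributed disturbance). -/
structure BCSData (X Z : Type*) [NormedAddCommGroup X] [InnerProductSpace ℂ X]
    [NormedAddCommGroup Z] [InnerProductSpace ℂ Z] (p n1 n3 : ℕ) where
  emb : Z →ₗ[ℂ] X
  emb_injective : Function.Injective emb
  A0 : Z →L[ℂ] X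
  B : Z →L[ℂ] EuclideanSpace ℂ (Fin p)
  Bdist : EuclideanSpace ℂ (Fin n1) →L[ℂ] X
  Bd : Z →L[ℂ] EuclideanSpace ℂ (Fin n3)
  C : Z →L[ℂ] EuclideanSpace ℂ (Fin p)

namespace BCSData

variable {X Z : Type*} [NormedAddCommGroup X] [InnerProductSpace ℂ X]
  [NormedAddCommGroup Z] [InnerProductSpace ℂ Z] {p n1 n3 : ℕ}

/-- The restriction of `𝔄₀` to a subspace `S ⊆ Z`, as an unbounded operator on `X`. -/
def restrict (sys : BCSData X Z p n1 n3) (S : Submodule ℂ Z) : X →ₗ.[ℂ] X where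
  domain := S.map sys.emb
  toFun := (sys.A0 : Z →ₗ[ℂ] X) ∘ₗ S.subtype ∘ₗ
    (Submodule.equivMapOfInjective sys.emb sys.emb_injective S).symm.toLinearMap

/-- `𝔄`, the restriction of `𝔄₀` to `D(𝔄) = ker 𝔅_d`. -/
def frakA (sys : BCSData X Z p n1 n3) : X →ₗ.[ℂ] X :=
  sys.restrict (LinearMap.ker (sys.Bd : Z →ₗ[ℂ] EuclideanSpace ℂ (Fin n3)))

/-- `A`, the restriction of `𝔄₀` to `D(A) = ker 𝔅 ∩ ker 𝔅_d`. -/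
def A (sys : BCSData X Z p n1 n3) : X →ₗ.[ℂ] X :=
  sys.restrict (LinearMap.ker (sys.B : Z →ₗ[ℂ] EuclideanSpace ℂ (Fin p)) ⊓
    LinearMap.ker (sys.Bd : Z →ₗ[ℂ] EuclideanSpace ℂ (Fin n3)))

/-- The standing assumptions: `A` generates a contraction semigroup, `(𝔅, 𝔅_d)` is jointly
surjective, and the system is impedance passive. -/
structure IsBCS (sys : BCSData X Z p n1 n3) : Prop where
  generates : ∃ S : C0Semigroup X, Generates sys.A S ∧ S.IsContraction
  surjective : Function.Surjective (fun z : Z => (sys.B z, sys.Bd z))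
  passive : ∀ z : Z, sys.Bd z = 0 →
    (⟪sys.A0 z, sys.emb z⟫_ℂ).re ≤ (⟪sys.B z, sys.C z⟫_ℂ).re

theorem restrict_apply (sys : BCSData X Z p n1 n3) (S : Submodule ℂ Z) (z : Z) (hz : z ∈ S)
    (h : sys.emb z ∈ (sys.restrict S).domain) :
    sys.restrict S ⟨sys.emb z, h⟩ = sys.A0 z := by
  have : (Submodule.equivMapOfInjective sys.emb sys.emb_injective S).symm ⟨sys.emb z, h⟩
      = ⟨z, hz⟩ := by
    rw [LinearEquiv.symm_apply_eq]
    ext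
    simp
  change sys.A0 ((Submodule.equivMapOfInjective sys.emb sys.emb_injective S).symm
    ⟨sys.emb z, h⟩ : S) = _
  rw [this]

/-- The solutions `z ∈ D(𝔄)` of `(lam - 𝔄) z = 0`. -/
def eigenspace (sys : BCSData X Z p n1 n3) (lam : ℂ) : Submodule ℂ Z :=
  LinearMap.ker (sys.Bd : Z →ₗ[ℂ] EuclideanSpace ℂ (Fin n3)) ⊓
    LinearMap.ker (lam • sys.emb - (sys.A0 : Z →ₗ[ℂ] X))

/-- `𝔅` on the solution space of `(lam - 𝔄) z = 0`. -/
def traceMap (sys : BCSData X Z p n1 n3) (lam : ℂ) :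
    sys.eigenspace lam →ₗ[ℂ] EuclideanSpace ℂ (Fin p) :=
  (sys.B : Z →ₗ[ℂ] EuclideanSpace ℂ (Fin p)) ∘ₗ (sys.eigenspace lam).subtype

/-- For `lam ∈ ρ(A)` and every `u`, the problem `(lam - 𝔄) z = 0`, `𝔅 z = u` has exactly one
solution. -/
theorem traceMap_bijective {sys : BCSData X Z p n1 n3} (hsys : sys.IsBCS) {lam : ℂ}
    (hl : lam ∈ resolventSet sys.A) : Function.Bijective (sys.traceMap lam) := by
  obtain ⟨R, hR1, hR2⟩ := hl
  constructor
  · rw [← LinearMap.ker_eq_bot, LinearMap.ker_eq_bot']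
    rintro ⟨z, hz⟩ hB
    have hB' : sys.B z = 0 := hB
    have hd : sys.Bd z = 0 := hz.1
    have he : lam • sys.emb z - sys.A0 z = 0 := hz.2
    have hmem : z ∈ LinearMap.ker (sys.B : Z →ₗ[ℂ] EuclideanSpace ℂ (Fin p)) ⊓
        LinearMap.ker (sys.Bd : Z →ₗ[ℂ] EuclideanSpace ℂ (Fin n3)) := ⟨hB', hd⟩
    have hdom : sys.emb z ∈ sys.A.domain := Submodule.mem_map_of_mem hmem
    have h1 := hR1 ⟨sys.emb z, hdom⟩
    have h2 : sys.A ⟨sys.emb z, hdom⟩ = sys.A0 z := sys.restrict_apply _ z hmem hdom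
    rw [h2] at h1
    simp only [he, map_zero] at h1
    have h3 : z = 0 := sys.emb_injective (by rw [map_zero]; exact h1.symm)
    exact Subtype.ext h3
  · intro u
    obtain ⟨z0, hz0⟩ := hsys.surjective (u, 0)
    have hB0 : sys.B z0 = u := congrArg Prod.fst hz0
    have hd0 : sys.Bd z0 = 0 := congrArg Prod.snd hz0
    obtain ⟨h, hR⟩ := hR2 (lam • sys.emb z0 - sys.A0 z0)
    obtain ⟨w, hw, hwe⟩ := id h
    have hBw : sys.B w = 0 := hw.1
    have hdw : sys.Bd w = 0 := hw.2
    have hdom : sys.emb w ∈ sys.A.domain := Submodule.mem_map_of_mem hw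
    have h2 : sys.A ⟨sys.emb w, hdom⟩ = sys.A0 w := sys.restrict_apply _ w hw hdom
    have h3 : sys.A ⟨_, h⟩ = sys.A0 w := by rw [← h2]; congr 1; exact Subtype.ext hwe.symm
    rw [h3, ← hwe] at hR
    refine ⟨⟨z0 - w, ?_, ?_⟩, ?_⟩
    · change sys.Bd (z0 - w) = 0
      rw [map_sub, hd0, hdw, sub_zero]
    · change lam • sys.emb (z0 - w) - sys.A0 (z0 - w) = 0
      rw [map_sub, map_sub, smul_sub, sub_sub_sub_comm, hR, sub_self]
    · change sys.B (z0 - w) = u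
      rw [map_sub, hB0, hBw, sub_zero]

/-- The transfer function at `lam ∈ ρ(A)`: `P(lam) u = 𝔠 z`, where `z ∈ D(𝔄)` is the solution
of `(lam - 𝔄) z = 0`, `𝔅 z = u`. -/
def transferFunction {sys : BCSData X Z p n1 n3} (hsys : sys.IsBCS) (lam : ℂ)
    (hl : lam ∈ resolventSet sys.A) :
    EuclideanSpace ℂ (Fin p) →L[ℂ] EuclideanSpace ℂ (Fin p) :=
  LinearMap.toContinuousLinearMap
    ((sys.C : Z →ₗ[ℂ] EuclideanSpace ℂ (Fin p)) ∘ₗ (sys.eigenspace lam).subtype ∘ₗ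
      (LinearEquiv.ofBijective (sys.traceMap lam)
        (traceMap_bijective hsys hl)).symm.toLinearMap)

/-- `A` generates an exponentially stable semigroup on `X`. -/
def IsExpStable (sys : BCSData X Z p n1 n3) : Prop :=
  ∃ S : C0Semigroup X, Generates sys.A S ∧ S.IsExpStable

/-- `± i ω_k ∈ ρ(A)` and `Re P(± i ω_k) > 0` for all `k ∈ {0, …, q}`. -/
def FreqPositive {sys : BCSData X Z p n1 n3} (hsys : sys.IsBCS) {q : ℕ}
    (ω : Fin (q + 1) → ℝ) : Prop :=
  ∀ k : Fin (q + 1), ∀ lam : ℂ,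
    (lam = Complex.I * (ω k : ℂ) ∨ lam = -(Complex.I * (ω k : ℂ))) →
      ∃ hl : lam ∈ resolventSet sys.A, OpPos (opRe (transferFunction hsys lam hl))

/-- The inclusion of `Z` as an identification of `Z` with the subspace `emb(Z)` of `X`. -/
def toRange (sys : BCSData X Z p n1 n3) : Z ≃ₗ[ℂ] LinearMap.range sys.emb :=
  LinearEquiv.ofInjective sys.emb sys.emb_injective

/-- An operator `H : V → X` with `ran H ⊆ Z`, regarded as a map `V → Z`. -/
def intoZ (sys : BCSData X Z p n1 n3) {V : Type*} [NormedAddCommGroup V]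
    [InnerProductSpace ℂ V] (H : V →L[ℂ] X)
    (hH : ∀ v, H v ∈ LinearMap.range sys.emb) : V →ₗ[ℂ] Z :=
  sys.toRange.symm.toLinearMap ∘ₗ (H : V →ₗ[ℂ] X).codRestrict (LinearMap.range sys.emb) hH

end BCSData

/-! ### The controller -/

/-- Coordinates of `X_c = ℂ^{p(2q+1)}`: one block of length `p` (for `ω_0 = 0`), followed for
each `k = 1, …, q` by a block of length `2p = p + p`. -/
abbrev CtrlIdx (p q : ℕ) : Type := Fin p ⊕ ((Fin p ⊕ Fin p) × Fin q)

theorem card_ctrlIdx (p q : ℕ) : Fintype.card (CtrlIdx p q) = p * (2 * q + 1) := by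
  simp only [Fintype.card_sum, Fintype.card_prod, Fintype.card_fin]
  ring

/-- The controller space `X_c`. -/
abbrev Xc (p q : ℕ) : Type := EuclideanSpace ℂ (CtrlIdx p q)

/-- The block `J_c^k = [[0, w I], [-w I, 0]]`. -/
def JcBlock (p : ℕ) (w : ℝ) : Matrix (Fin p ⊕ Fin p) (Fin p ⊕ Fin p) ℂ :=
  Matrix.fromBlocks 0 ((w : ℂ) • 1) (-((w : ℂ) • 1)) 0

/-- `J_c = blkdiag(0, J_c^1, …, J_c^q)`. -/
def JcMat (p : ℕ) {q : ℕ} (ω : Fin (q + 1) → ℝ) :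
    Matrix (CtrlIdx p q) (CtrlIdx p q) ℂ :=
  Matrix.fromBlocks 0 0 0 (Matrix.blockDiagonal fun k : Fin q => JcBlock p (ω k.succ))

/-- The column of blocks `B_c^0 = I`, `B_c^k = [I; 0]`. -/
def BcMat (p q : ℕ) : Matrix (CtrlIdx p q) (Fin p) ℂ :=
  Matrix.fromRows 1 (Matrix.of fun ik j =>
    (Matrix.fromRows 1 0 : Matrix (Fin p ⊕ Fin p) (Fin p) ℂ) ik.1 j)

/-- `J_c` as an operator on `X_c`. -/
def Jc (p : ℕ) {q : ℕ} (ω : Fin (q + 1) → ℝ) : Xc p q →L[ℂ] Xc p q :=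
  LinearMap.toContinuousLinearMap (Matrix.toEuclideanLin (JcMat p ω))

/-- `B_c` as an operator from `ℂ^p` to `X_c`. -/
def Bc (p q : ℕ) : EuclideanSpace ℂ (Fin p) →L[ℂ] Xc p q :=
  LinearMap.toContinuousLinearMap (Matrix.toEuclideanLin (BcMat p q))

end

end RobustReg

namespace RobustReg

/-! ### Lyapunov equations in finite dimensions -/

section Lyapunov

variable {E : Type*} [NormedAddCommGroup E] [InnerProductSpace ℂ E]

/-! The matrix `Jc` is skew-adjoint with distinct eigenvalues `iθ_j`, so `Xc` is the orthogonal sum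
of its spectral subspaces, each parametrised by `ℂ^p` through `modeVec j`. Define `H` mode by mode:
`modeVec j u` goes to minus the solution of the boundary problem at `iθ_j` with data `u`. The
intertwining relation and the boundary condition then hold on each mode.

Put `M = Bc ∘L CH`. Since `Bc*` maps `modeVec j u` back to `u`, the form of `M` on mode `j` is `-⟪u,
P(iθ_j) u⟫`, so `Re P(iθ_j) > 0` makes every diagonal block of `M` strictly dissipative. The
off-diagonal blocks have no sign, but for small `ε = δ²` they average out: the self-adjoint `K` of
`exists_commutator_eq` cancels them at order `ε`, so `Q = 1 + εK` is a strict Lyapunov form for `J +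
εM` with decay rate of order `ε`.

It remains to pass from the inequality for `Q` to the equation with right-hand side `-εI`. No matrix
exponential is needed: the comparison principle `re_inner_pos_of_lyapunov` makes the Lyapunov map
injective, hence bijective in finite dimension, and bounds the solution by a multiple of `Q`. The
multiple depends only on the ratio of `ε` to the decay rate, which makes the bound uniform in `δ`.
-/

theorem re_inner_symm_of_isSelfAdjoint [CompleteSpace E] {S : E →L[ℂ] E} (hS : IsSelfAdjoint S)
    (x y : E) : (⟪S x, y⟫_ℂ).re = (⟪S y, x⟫_ℂ).re := by
  rw [← ContinuousLinearMap.adjoint_inner_right, hS.adjoint_eq, ← inner_conj_symm,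
    Complex.conj_re]

theorem re_inner_sub_smul (S Q : E →L[ℂ] E) (m : ℝ) (x y : E) :
    (⟪(S - (m : ℂ) • Q) x, y⟫_ℂ).re = (⟪S x, y⟫_ℂ).re - m * (⟪Q x, y⟫_ℂ).re := by
  simp

theorem isSelfAdjoint_sub_smul [CompleteSpace E] {S Q : E →L[ℂ] E} (hS : IsSelfAdjoint S)
    (hQ : IsSelfAdjoint Q) (m : ℝ) : IsSelfAdjoint (S - (m : ℂ) • Q) :=
  hS.sub (IsSelfAdjoint.smul (by simp [isSelfAdjoint_iff]) hQ)

/-- A zero of the quadratic form of a nonnegative self-adjoint operator is a critical point. -/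
theorem re_inner_eq_zero_of_nonneg [CompleteSpace E] {T : E →L[ℂ] E} (hT : IsSelfAdjoint T)
    (hpos : ∀ x, 0 ≤ (⟪T x, x⟫_ℂ).re) {x : E} (hx : (⟪T x, x⟫_ℂ).re = 0) (y : E) :
    (⟪T x, y⟫_ℂ).re = 0 := by
  -- Along the line through `x` in direction `y` the form is a nonnegative quadratic in `t` with
  -- zero constant term, so its discriminant forces the linear coefficient to vanish.
  have key : ∀ t : ℝ, 0 ≤ (⟪T y, y⟫_ℂ).re * (t * t) + (2 * (⟪T x, y⟫_ℂ).re) * t + 0 := by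
    intro t
    have h := hpos (x + (t : ℂ) • y)
    have h2 := re_inner_symm_of_isSelfAdjoint hT y x
    simp only [map_add, map_smul, inner_add_left, inner_add_right, inner_smul_left,
      inner_smul_right, Complex.add_re, Complex.conj_ofReal, Complex.re_ofReal_mul, hx, h2] at h
    linarith
  have := discrim_le_zero key
  rw [discrim] at this
  nlinarith [sq_nonneg (⟪T x, y⟫_ℂ).re]

/-- If `A` strictly decreases both `S` and the positive definite form `Q`, then `S` is positive
definite. -/
theorem re_inner_pos_of_lyapunov [FiniteDimensional ℂ E] {S Q A : E →L[ℂ] E}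
    (hS : IsSelfAdjoint S) (hQ : IsSelfAdjoint Q) (hQpos : ∀ x, x ≠ 0 → 0 < (⟪Q x, x⟫_ℂ).re)
    (hSA : ∀ x, x ≠ 0 → (⟪S x, A x⟫_ℂ).re < 0) (hQA : ∀ x, x ≠ 0 → (⟪Q x, A x⟫_ℂ).re < 0)
    {x : E} (hx : x ≠ 0) : 0 < (⟪S x, x⟫_ℂ).re := by
  have : ProperSpace E := FiniteDimensional.proper ℂ E
  -- At a minimiser `x0` of this generalised Rayleigh quotient, `S - f x0 • Q` is nonnegative and
  -- its form vanishes at `x0`, so `x0` is a critical point. The aim is `0 < f x0`.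
  set f : E → ℝ := fun x => (⟪S x, x⟫_ℂ).re / (⟪Q x, x⟫_ℂ).re with hf
  have hne : (Metric.sphere (0 : E) 1).Nonempty :=
    ⟨((‖x‖ : ℂ)⁻¹) • x, by simp [norm_smul, inv_mul_cancel₀ (norm_ne_zero_iff.2 hx)]⟩
  have hcont : ContinuousOn f (Metric.sphere (0 : E) 1) := by
    refine ContinuousOn.div ?_ ?_ ?_
    · exact Continuous.continuousOn (by fun_prop)
    · exact Continuous.continuousOn (by fun_prop)
    · intro y hy
      exact (hQpos y (ne_zero_of_mem_unit_sphere ⟨y, hy⟩)).ne'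
  obtain ⟨x0, hx0, hmin⟩ := (isCompact_sphere (0 : E) 1).exists_isMinOn hne hcont
  have hx0' : x0 ≠ 0 := ne_zero_of_mem_unit_sphere ⟨x0, hx0⟩
  have hle : ∀ y, 0 ≤ (⟪(S - (f x0 : ℂ) • Q) y, y⟫_ℂ).re := by
    intro y
    rw [re_inner_sub_smul]
    rcases eq_or_ne y 0 with rfl | hy
    · simp
    have hy' : (‖y‖ : ℝ) ≠ 0 := norm_ne_zero_iff.2 hy
    have h1 : f x0 ≤ f (((‖y‖⁻¹ : ℝ) : ℂ) • y) :=
      hmin (show _ ∈ Metric.sphere (0 : E) 1 by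
        simp [norm_smul, inv_mul_cancel₀ hy'])
    have h2 : f (((‖y‖⁻¹ : ℝ) : ℂ) • y) = f y := by
      simp only [hf, map_smul, inner_smul_left, inner_smul_right, Complex.conj_ofReal,
        Complex.re_ofReal_mul]
      field_simp
    rw [h2] at h1
    have h3 := (le_div_iff₀ (hQpos y hy)).1 h1
    linarith
  have hzero : (⟪(S - (f x0 : ℂ) • Q) x0, x0⟫_ℂ).re = 0 := by
    rw [re_inner_sub_smul]
    simp only [hf]
    rw [div_mul_cancel₀ _ (hQpos x0 hx0').ne', sub_self]
  -- Testing criticality in the direction `A x0` gives `Re⟪S x0, A x0⟫ = f x0 * Re⟪Q x0, A x0⟫`;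
  -- both inner products have negative real part, so `f x0 > 0`.
  have hcrit := re_inner_eq_zero_of_nonneg (isSelfAdjoint_sub_smul hS hQ _) hle hzero (A x0)
  rw [re_inner_sub_smul] at hcrit
  have hm : 0 < f x0 := by
    have h1 := hSA x0 hx0'
    have h2 := hQA x0 hx0'
    by_contra! hcon
    nlinarith
  have h1 := hle x
  rw [re_inner_sub_smul] at h1
  have := mul_pos hm (hQpos x hx)
  linarith

theorem lyapunov_apply [CompleteSpace E] {P A : E →L[ℂ] E} (hP : IsSelfAdjoint P) {s : ℝ}
    (h : P ∘L A + ContinuousLinearMap.adjoint A ∘L P = -((s : ℂ) • ContinuousLinearMap.id ℂ E))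
    (x : E) : 2 * (⟪P x, A x⟫_ℂ).re = -(s * ‖x‖ ^ 2) := by
  have h1 := congrArg (fun T : E →L[ℂ] E => (⟪T x, x⟫_ℂ).re) h
  simp only [add_apply, ContinuousLinearMap.comp_apply, inner_add_left,
    ContinuousLinearMap.adjoint_inner_left, Complex.add_re, neg_apply, smul_apply,
    ContinuousLinearMap.id_apply, inner_neg_left, inner_smul_left, Complex.conj_ofReal,
    Complex.neg_re, Complex.re_ofReal_mul] at h1
  rw [re_inner_symm_of_isSelfAdjoint hP (A x) x] at h1
  have h2 : (⟪x, x⟫_ℂ).re = ‖x‖ ^ 2 := inner_self_eq_norm_sq (𝕜 := ℂ) x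
  rw [h2] at h1
  linarith

/-- Comparison of a Lyapunov solution with a strict Lyapunov form. -/
theorem lyapunov_upper_bound [FiniteDimensional ℂ E] {P Q A : E →L[ℂ] E}
    (hP : IsSelfAdjoint P) (hQ : IsSelfAdjoint Q) (hQpos : ∀ x, x ≠ 0 → 0 < (⟪Q x, x⟫_ℂ).re)
    {r s m : ℝ} (hr : 0 < r) (hQA : ∀ x, 2 * (⟪Q x, A x⟫_ℂ).re ≤ -(r * ‖x‖ ^ 2))
    (h : P ∘L A + ContinuousLinearMap.adjoint A ∘L P = -((s : ℂ) • ContinuousLinearMap.id ℂ E))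
    (hm0 : 0 ≤ m) (hm : s < m * r) (x : E) : (⟪P x, x⟫_ℂ).re ≤ m * (⟪Q x, x⟫_ℂ).re := by
  rcases eq_or_ne x 0 with rfl | hx
  · simp
  have hsq : ∀ y : E, y ≠ 0 → 0 < ‖y‖ ^ 2 := fun y hy => by positivity
  -- The comparison principle is applied to `m Q - P`; the strict inequality `s < m * r` makes it
  -- strictly decreasing along `A`.
  have hS : IsSelfAdjoint (-(P - (m : ℂ) • Q)) := (isSelfAdjoint_sub_smul hP hQ m).neg
  have := re_inner_pos_of_lyapunov (A := A) hS hQ hQpos ?_ ?_ hx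
  · rw [neg_apply, inner_neg_left, Complex.neg_re, re_inner_sub_smul] at this
    linarith
  · intro y hy
    rw [neg_apply, inner_neg_left, Complex.neg_re, re_inner_sub_smul]
    have h1 := lyapunov_apply hP h y
    have h2 := mul_le_mul_of_nonneg_left (hQA y) hm0
    have h3 := mul_lt_mul_of_pos_right hm (hsq y hy)
    linarith
  · intro y hy
    have h1 := hQA y
    have h2 := mul_pos hr (hsq y hy)
    linarith

/-- With `s = 0` the comparison with `m Q` is available for every `m > 0`, so the form of `P` is
nonpositive; the same applies to `-P`. -/
theorem lyapunov_unique_zero [FiniteDimensional ℂ E] {P Q A : E →L[ℂ] E}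
    (hP : IsSelfAdjoint P) (hQ : IsSelfAdjoint Q) (hQpos : ∀ x, x ≠ 0 → 0 < (⟪Q x, x⟫_ℂ).re)
    {r : ℝ} (hr : 0 < r) (hQA : ∀ x, 2 * (⟪Q x, A x⟫_ℂ).re ≤ -(r * ‖x‖ ^ 2))
    (h : P ∘L A + ContinuousLinearMap.adjoint A ∘L P = 0) : P = 0 := by
  have hle : ∀ R : E →L[ℂ] E, IsSelfAdjoint R →
      R ∘L A + ContinuousLinearMap.adjoint A ∘L R = 0 → ∀ x, (⟪R x, x⟫_ℂ).re ≤ 0 := by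
    intro R hR hRA x
    by_contra! hcon
    have hx : x ≠ 0 := by rintro rfl; simp at hcon
    have hq := hQpos x hx
    -- This `m` would bound the positive number `Re⟪R x, x⟫` by half of itself.
    have := lyapunov_upper_bound (s := 0) (m := (⟪R x, x⟫_ℂ).re / (2 * (⟪Q x, x⟫_ℂ).re)) hR hQ
      hQpos hr hQA (by simpa using hRA) (by positivity) (by positivity) x
    rw [div_mul_eq_mul_div, mul_div_mul_right _ _ hq.ne'] at this
    linarith
  have h1 := hle P hP h
  have h2 := hle (-P) hP.neg (by
    rw [ContinuousLinearMap.neg_comp, ContinuousLinearMap.comp_neg, ← neg_add, h, neg_zero])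
  have h3 : ∀ x, (⟪P x, x⟫_ℂ).re = 0 := fun x => le_antisymm (h1 x) (by
    have := h2 x
    rw [neg_apply, inner_neg_left, Complex.neg_re] at this
    linarith)
  ext x
  have h4 := re_inner_eq_zero_of_nonneg hP (fun x => (h3 x).ge) (h3 x) (P x)
  have h5 : (⟪P x, P x⟫_ℂ).re = ‖P x‖ ^ 2 := inner_self_eq_norm_sq (𝕜 := ℂ) (P x)
  rw [h5] at h4
  simpa using h4

/-- The Lyapunov operator `P ↦ P A + A* P`. -/
noncomputable def lyapunovMap [CompleteSpace E] (A : E →L[ℂ] E) :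
    (E →L[ℂ] E) →ₗ[ℂ] (E →L[ℂ] E) where
  toFun P := P ∘L A + ContinuousLinearMap.adjoint A ∘L P
  map_add' P R := by
    rw [ContinuousLinearMap.add_comp, ContinuousLinearMap.comp_add]; abel
  map_smul' c P := by
    rw [ContinuousLinearMap.smul_comp, ContinuousLinearMap.comp_smul, RingHom.id_apply, smul_add]

theorem adjoint_lyapunovMap [CompleteSpace E] (A P : E →L[ℂ] E) :
    ContinuousLinearMap.adjoint (lyapunovMap A P) =
      lyapunovMap A (ContinuousLinearMap.adjoint P) := by
  simp only [lyapunovMap, LinearMap.coe_mk, AddHom.coe_mk, map_add,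
    ContinuousLinearMap.adjoint_comp, ContinuousLinearMap.adjoint_adjoint]
  rw [add_comm]

/-- The kernel is closed under adjoints, so the self-adjoint case applies to `P + P*` and to `i(P -
P*)`. -/
theorem lyapunovMap_injective [FiniteDimensional ℂ E] {Q A : E →L[ℂ] E}
    (hQ : IsSelfAdjoint Q) (hQpos : ∀ x, x ≠ 0 → 0 < (⟪Q x, x⟫_ℂ).re)
    {r : ℝ} (hr : 0 < r) (hQA : ∀ x, 2 * (⟪Q x, A x⟫_ℂ).re ≤ -(r * ‖x‖ ^ 2)) :
    Function.Injective (lyapunovMap A) := by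
  rw [← LinearMap.ker_eq_bot, LinearMap.ker_eq_bot']
  intro P hP
  have hstar : lyapunovMap A (star P) = 0 := by
    rw [ContinuousLinearMap.star_eq_adjoint, ← adjoint_lyapunovMap, hP, map_zero]
  have h1 : P + star P = 0 :=
    lyapunov_unique_zero (IsSelfAdjoint.add_star_self P) hQ hQpos hr hQA (by
      change lyapunovMap A _ = 0
      rw [map_add, hP, hstar, add_zero])
  have h2 : Complex.I • (P - star P) = 0 :=
    lyapunov_unique_zero (by
      rw [isSelfAdjoint_iff, star_smul, star_sub, star_star, Complex.star_def, Complex.conj_I,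
        neg_smul, ← smul_neg, neg_sub]) hQ hQpos hr hQA (by
      change lyapunovMap A _ = 0
      rw [map_smul, map_sub, hP, hstar, sub_zero, smul_zero])
  have h3 : P - star P = 0 := (smul_eq_zero.1 h2).resolve_left Complex.I_ne_zero
  have h4 : (2 : ℂ) • P = 0 := by
    rw [two_smul, ← add_zero (P + P), ← h1, ← sub_eq_zero.1 h3]
    rw [← sub_eq_zero.1 h3] at h1
    rw [h1, add_zero]
  exact (smul_eq_zero.1 h4).resolve_left two_ne_zero

theorem opNorm_le_of_isSelfAdjoint [CompleteSpace E] {P : E →L[ℂ] E} (hP : IsSelfAdjoint P)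
    (hpos : ∀ x, 0 ≤ (⟪P x, x⟫_ℂ).re) {c : ℝ} (hc : 0 ≤ c)
    (hle : ∀ x, (⟪P x, x⟫_ℂ).re ≤ c * ‖x‖ ^ 2) : ‖P‖ ≤ c := by
  rw [ContinuousLinearMap.norm_eq_iSup_rayleighQuotient P hP.isSymmetric]
  refine ciSup_le fun x => ?_
  have h1 : P.reApplyInnerSelf x = (⟪P x, x⟫_ℂ).re := rfl
  rw [ContinuousLinearMap.rayleighQuotient, h1, abs_of_nonneg (div_nonneg (hpos x) (by positivity))]
  exact div_le_of_le_mul₀ (by positivity) hc (hle x)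

/-- A strict Lyapunov form `Q` yields the solution of the Lyapunov equation with right-hand side
`-s I`, with a bound which depends only on `Q` and the ratio of `s` to the decay rate. -/
theorem exists_lyapunov_solution [FiniteDimensional ℂ E] {Q A : E →L[ℂ] E}
    (hQ : IsSelfAdjoint Q) {b c : ℝ} (hb : 0 < b) (hQlow : ∀ x, b * ‖x‖ ^ 2 ≤ (⟪Q x, x⟫_ℂ).re)
    (hQup : ∀ x, (⟪Q x, x⟫_ℂ).re ≤ c * ‖x‖ ^ 2) (hc : 0 ≤ c)
    {r s m : ℝ} (hr : 0 < r) (hs : 0 < s) (hm0 : 0 ≤ m) (hm : s < m * r)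
    (hQA : ∀ x, 2 * (⟪Q x, A x⟫_ℂ).re ≤ -(r * ‖x‖ ^ 2)) :
    ∃ P : E →L[ℂ] E, OpPos P ∧ ‖P‖ ≤ m * c ∧
      P ∘L A + ContinuousLinearMap.adjoint A ∘L P =
        -((s : ℂ) • ContinuousLinearMap.id ℂ E) := by
  have hsq : ∀ y : E, y ≠ 0 → 0 < ‖y‖ ^ 2 := fun y hy => by positivity
  have hQpos : ∀ x, x ≠ 0 → 0 < (⟪Q x, x⟫_ℂ).re := fun x hx =>
    (mul_pos hb (hsq x hx)).trans_le (hQlow x)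
  have hinj := lyapunovMap_injective hQ hQpos hr hQA
  obtain ⟨P, hP⟩ := (LinearMap.injective_iff_surjective.1 hinj)
    (-((s : ℂ) • ContinuousLinearMap.id ℂ E))
  -- The right-hand side is self-adjoint, so `P` and `P*` solve the same equation.
  have hPsa : IsSelfAdjoint P := by
    refine hinj ?_
    rw [ContinuousLinearMap.star_eq_adjoint, ← adjoint_lyapunovMap, hP]
    rw [map_neg, map_smulₛₗ, ContinuousLinearMap.adjoint_id, Complex.conj_ofReal]
  have hup := lyapunov_upper_bound hPsa hQ hQpos hr hQA hP hm0 hm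
  -- `d - 1` bounds the rate at which `Q` can decrease along `A`; the extra `1` makes `P - (s / d)
  -- Q` strictly decreasing, whence the lower bound on `P`.
  set d : ℝ := 2 * ‖Q‖ * ‖A‖ + 1 with hd
  have hdpos : 0 < d := by positivity
  have hQA' : ∀ x, -(2 * (⟪Q x, A x⟫_ℂ).re) ≤ (d - 1) * ‖x‖ ^ 2 := by
    intro x
    have h1 : |(⟪Q x, A x⟫_ℂ).re| ≤ ‖Q x‖ * ‖A x‖ :=
      (Complex.abs_re_le_norm _).trans (norm_inner_le_norm _ _)
    have h2 : ‖Q x‖ * ‖A x‖ ≤ (‖Q‖ * ‖x‖) * (‖A‖ * ‖x‖) :=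
      mul_le_mul (Q.le_opNorm x) (A.le_opNorm x) (norm_nonneg _) (by positivity)
    have h3 := neg_abs_le (⟪Q x, A x⟫_ℂ).re
    rw [hd]
    nlinarith
  have hlow : ∀ x, s / d * b * ‖x‖ ^ 2 ≤ (⟪P x, x⟫_ℂ).re := by
    intro x
    rcases eq_or_ne x 0 with rfl | hx
    · simp
    have := re_inner_pos_of_lyapunov (A := A) (isSelfAdjoint_sub_smul hPsa hQ (s / d)) hQ hQpos
      ?_ ?_ hx
    · rw [re_inner_sub_smul] at this
      have h1 := mul_le_mul_of_nonneg_left (hQlow x) (div_pos hs hdpos).le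
      linarith
    · intro y hy
      rw [re_inner_sub_smul]
      have h1 := lyapunov_apply hPsa hP y
      have h2 := mul_le_mul_of_nonneg_left (hQA' y) (div_pos hs hdpos).le
      have h3 : s / d * ((d - 1) * ‖y‖ ^ 2) = s * ‖y‖ ^ 2 - s / d * ‖y‖ ^ 2 := by
        field_simp
      have h4 := mul_pos (div_pos hs hdpos) (hsq y hy)
      linarith
    · intro y hy
      have h1 := hQA y
      have h2 := mul_pos hr (hsq y hy)
      linarith
  refine ⟨P, ⟨s / d * b, by positivity, ?_⟩, ?_, hP⟩
  · rw [ContinuousLinearMap.isPositive_def']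
    refine ⟨isSelfAdjoint_sub_smul hPsa (IsSelfAdjoint.one _) _, fun x => ?_⟩
    change 0 ≤ (⟪(P - ((s / d * b : ℝ) : ℂ) • ContinuousLinearMap.id ℂ E) x, x⟫_ℂ).re
    rw [re_inner_sub_smul, ContinuousLinearMap.id_apply]
    have h2 : (⟪x, x⟫_ℂ).re = ‖x‖ ^ 2 := inner_self_eq_norm_sq (𝕜 := ℂ) x
    rw [h2]
    linarith [hlow x]
  · refine opNorm_le_of_isSelfAdjoint hPsa (fun x => le_trans (by positivity) (hlow x))
      (by positivity) fun x => (hup x).trans ?_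
    rw [mul_assoc]
    exact mul_le_mul_of_nonneg_left (hQup x) hm0

end Lyapunov

/-! ### Perturbation of a skew-adjoint operator -/

section Perturbation

variable {E : Type*} [NormedAddCommGroup E] [InnerProductSpace ℂ E]

/-- First-order averaging: the off-diagonal part of `N` with respect to the spectral projections of
`J` is a commutator with `J`. -/
theorem exists_commutator_eq [CompleteSpace E] {ι : Type*} [Fintype ι]
    {Pr : ι → E →L[ℂ] E} {J N : E →L[ℂ] E} {θ : ι → ℝ} (hθ : Function.Injective θ)
    (hsa : ∀ j, IsSelfAdjoint (Pr j)) (hsum : ∑ j, Pr j = 1)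
    (hJl : ∀ j, J * Pr j = (Complex.I * (θ j : ℂ)) • Pr j)
    (hJr : ∀ j, Pr j * J = (Complex.I * (θ j : ℂ)) • Pr j) (hN : IsSelfAdjoint N) :
    ∃ K : E →L[ℂ] E, IsSelfAdjoint K ∧ N + (K * J - J * K) = ∑ j, Pr j * N * Pr j := by
  classical
  -- The coefficient solves `c (iθ_j - iθ_i) = -1` on each off-diagonal block. For `i = j` it is `I
  -- / 0 = 0`, so the diagonal blocks contribute nothing to `K`.
  refine ⟨∑ i, ∑ j, (Complex.I / ((θ j : ℂ) - (θ i : ℂ))) • (Pr i * N * Pr j), ?_, ?_⟩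
  · rw [isSelfAdjoint_iff, star_sum, Finset.sum_comm]
    simp only [star_sum]
    refine Finset.sum_congr rfl fun i _ => Finset.sum_congr rfl fun j _ => ?_
    rw [star_smul, star_mul, star_mul, (hsa i).star_eq, (hsa j).star_eq, hN.star_eq, mul_assoc]
    congr 1
    simp only [Complex.star_def, map_div₀, map_sub, Complex.conj_I, Complex.conj_ofReal]
    rw [neg_div, ← div_neg, neg_sub]
  · have h1 : N = ∑ i, ∑ j, Pr i * N * Pr j := by
      conv_lhs => rw [← one_mul N, ← mul_one (1 * N), ← hsum]
      rw [Finset.sum_mul, Finset.sum_mul]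
      simp only [Finset.mul_sum]
    conv_lhs => enter [1]; rw [h1]
    rw [Finset.sum_mul, Finset.mul_sum, ← Finset.sum_sub_distrib, ← Finset.sum_add_distrib]
    refine Finset.sum_congr rfl fun i _ => ?_
    rw [Finset.sum_mul, Finset.mul_sum, ← Finset.sum_sub_distrib, ← Finset.sum_add_distrib,
      Finset.sum_eq_single i]
    · simp
    · intro j _ hji
      have hne : (θ j : ℂ) - (θ i : ℂ) ≠ 0 := by
        rw [sub_ne_zero]
        exact fun h => hji (hθ (by exact_mod_cast h))
      rw [smul_mul_assoc, mul_smul_comm, mul_assoc (Pr i * N), hJr, ← mul_assoc J, ← mul_assoc J,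
        hJl, mul_smul_comm, smul_mul_assoc, smul_mul_assoc, smul_smul, smul_smul, ← sub_smul]
      have : Complex.I / ((θ j : ℂ) - θ i) * (Complex.I * θ j) -
          Complex.I / ((θ j : ℂ) - θ i) * (Complex.I * θ i) = -1 := by
        field_simp
        linear_combination Complex.I_sq
      rw [this, neg_one_smul, add_neg_cancel]
    · simp

/-- The corrected form `1 + εK` sees only the diagonal blocks of `M` at order `ε`. It decays at rate
`εα` and stays between `1/2` and `3/2`, so the solution bound does not degenerate as `ε → 0`. -/
theorem exists_lyapunov_solution_of_small_perturbation [FiniteDimensional ℂ E]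
    {ι : Type*} [Fintype ι] {Pr : ι → E →L[ℂ] E} {J M : E →L[ℂ] E} {θ : ι → ℝ}
    (hθ : Function.Injective θ) (hsa : ∀ j, IsSelfAdjoint (Pr j))
    (hidem : ∀ j, Pr j * Pr j = Pr j) (hsum : ∑ j, Pr j = 1)
    (hJ : star J = -J) (hJl : ∀ j, J * Pr j = (Complex.I * (θ j : ℂ)) • Pr j)
    {α : ℝ} (hα : 0 < α)
    (hM : ∀ j x, (⟪Pr j x, M (Pr j x)⟫_ℂ).re ≤ -(α * ‖Pr j x‖ ^ 2)) :
    ∃ ε₀ Mc : ℝ, 0 < ε₀ ∧ 0 < Mc ∧ ∀ ε : ℝ, 0 < ε → ε < ε₀ →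
      ∃ P : E →L[ℂ] E, OpPos P ∧ ‖P‖ ≤ Mc ∧
        P ∘L (J + (ε : ℂ) • M) + ContinuousLinearMap.adjoint (J + (ε : ℂ) • M) ∘L P =
          -((ε : ℂ) • ContinuousLinearMap.id ℂ E) := by
  have hJr : ∀ j, Pr j * J = (Complex.I * (θ j : ℂ)) • Pr j := by
    intro j
    have h := congrArg star (hJl j)
    rw [star_mul, star_smul, (hsa j).star_eq, hJ, mul_neg] at h
    rw [neg_eq_iff_eq_neg.1 h, ← neg_smul]
    congr 1
    simp
  obtain ⟨K, hK, hKJ⟩ := exists_commutator_eq hθ hsa hsum hJl hJr (IsSelfAdjoint.add_star_self M)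
  have hadj : ∀ (T : E →L[ℂ] E) (x y : E), ⟪x, (star T) y⟫_ℂ = ⟪T x, y⟫_ℂ := fun T x y => by
    rw [ContinuousLinearMap.star_eq_adjoint, ContinuousLinearMap.adjoint_inner_right]
  have hsymm : ∀ x y : E, (⟪x, y⟫_ℂ).re = (⟪y, x⟫_ℂ).re := fun x y =>
    inner_re_symm (𝕜 := ℂ) x y
  have hself : ∀ x : E, (⟪x, x⟫_ℂ).re = ‖x‖ ^ 2 := fun x => inner_self_eq_norm_sq (𝕜 := ℂ) x
  have hmul : ∀ (S T : E →L[ℂ] E) (x : E), (S * T) x = S (T x) := fun _ _ _ => rfl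
  have hone : ∀ x : E, (1 : E →L[ℂ] E) x = x := fun _ => rfl
  have hPrinner : ∀ j x y, ⟪x, Pr j y⟫_ℂ = ⟪Pr j x, y⟫_ℂ := fun j x y => by
    rw [← hadj, (hsa j).star_eq]
  have hJskew : ∀ x y : E, ⟪J x, y⟫_ℂ = -⟪x, J y⟫_ℂ := fun x y => by
    rw [← hadj, hJ, neg_apply, inner_neg_right]
  have hdiag : ∀ x, (⟪x, ((M + star M) + (K * J - J * K)) x⟫_ℂ).re ≤ -(2 * α * ‖x‖ ^ 2) := by
    intro x
    have hnorm : ‖x‖ ^ 2 = ∑ j, ‖Pr j x‖ ^ 2 := by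
      rw [← hself]
      have h1 : x = ∑ j, Pr j x := by
        rw [← sum_apply, hsum]; rfl
      conv_lhs => arg 1; arg 2; rw [h1]
      rw [sum_inner, Complex.re_sum]
      refine Finset.sum_congr rfl fun j _ => ?_
      have h2 : Pr j (Pr j x) = Pr j x := by rw [← hmul, hidem]
      rw [← hself, ← hPrinner j x (Pr j x), h2, hsymm]
    rw [hKJ, sum_apply, inner_sum, Complex.re_sum, hnorm, Finset.mul_sum,
      ← Finset.sum_neg_distrib]
    refine Finset.sum_le_sum fun j _ => ?_
    have h2 := hM j x
    rw [hmul, hmul, hPrinner, add_apply, inner_add_right, hadj, Complex.add_re,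
      hsymm (M _)]
    linarith
  -- In powers of `ε`: the constant term vanishes because `J` is skew, the linear term is the
  -- averaged form of `hdiag`, and the quadratic term is `2 Re⟪K x, M x⟫`.
  have hQA : ∀ ε : ℝ, 0 < ε → ∀ x,
      2 * (⟪(1 + (ε : ℂ) • K) x, (J + (ε : ℂ) • M) x⟫_ℂ).re ≤
        -(2 * ε * (α - ε * (‖K‖ * ‖M‖)) * ‖x‖ ^ 2) := by
    intro ε hε x
    have h1 := hdiag x
    have h0 : (⟪x, J x⟫_ℂ).re = 0 := by
      have h := congrArg Complex.re (hJskew x x)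
      rw [hsymm, Complex.neg_re] at h
      linarith
    have h2 : (⟪K x, M x⟫_ℂ).re ≤ ‖K‖ * ‖M‖ * ‖x‖ ^ 2 := by
      refine (Complex.re_le_norm _).trans ((norm_inner_le_norm _ _).trans ?_)
      calc ‖K x‖ * ‖M x‖ ≤ (‖K‖ * ‖x‖) * (‖M‖ * ‖x‖) :=
            mul_le_mul (K.le_opNorm x) (M.le_opNorm x) (norm_nonneg _) (by positivity)
        _ = _ := by ring
    have hKin : ∀ y, ⟪x, K y⟫_ℂ = ⟪K x, y⟫_ℂ := fun y => by
      rw [← hadj, hK.star_eq]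
    have h3 : (⟪x, J (K x)⟫_ℂ).re = -(⟪K x, J x⟫_ℂ).re := by
      have h := congrArg Complex.re (hJskew x (K x))
      rw [hsymm, Complex.neg_re] at h
      linarith
    simp only [add_apply, sub_apply, hmul, inner_add_right, inner_sub_right, hadj, hKin,
      Complex.add_re, Complex.sub_re, h3, hsymm (M x) x] at h1
    simp only [add_apply, smul_apply, hone, inner_add_left, inner_add_right,
      inner_smul_left, inner_smul_right, Complex.add_re, Complex.conj_ofReal,
      Complex.re_ofReal_mul, h0]
    have h4 := mul_le_mul_of_nonneg_left h1 hε.le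
    have h5 := mul_le_mul_of_nonneg_left h2 (mul_pos hε hε).le
    linarith
  -- The first threshold gives `ε‖K‖ < 1/2`, hence the bounds on `Q`; the second gives `ε‖K‖‖M‖ <
  -- α/2`, leaving decay rate `εα`. In `Mc`, `3/2` bounds `Q` and `m = 2/α` gives `m * (εα) = 2ε`,
  -- strictly above `s = ε`.
  refine ⟨min (1 / (2 * (‖K‖ + 1))) (α / (2 * (‖K‖ * ‖M‖ + 1))), 2 / α * (3 / 2),
    lt_min (by positivity) (by positivity), by positivity, fun ε hε hlt => ?_⟩
  have hε1 : ε * (2 * (‖K‖ + 1)) < 1 :=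
    (lt_div_iff₀ (by positivity)).1 (hlt.trans_le (min_le_left _ _))
  have hε2 : ε * (2 * (‖K‖ * ‖M‖ + 1)) < α :=
    (lt_div_iff₀ (by positivity)).1 (hlt.trans_le (min_le_right _ _))
  have hQin : ∀ x, (⟪(1 + (ε : ℂ) • K) x, x⟫_ℂ).re = ‖x‖ ^ 2 + ε * (⟪K x, x⟫_ℂ).re := by
    intro x
    simp only [add_apply, smul_apply, hone, inner_add_left, inner_smul_left,
      Complex.add_re, Complex.conj_ofReal, Complex.re_ofReal_mul, hself]
  have hKb : ∀ x, |ε * (⟪K x, x⟫_ℂ).re| ≤ 1 / 2 * ‖x‖ ^ 2 := by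
    intro x
    have h1 : |(⟪K x, x⟫_ℂ).re| ≤ ‖K‖ * ‖x‖ ^ 2 := by
      refine (Complex.abs_re_le_norm _).trans ((norm_inner_le_norm _ _).trans ?_)
      calc ‖K x‖ * ‖x‖ ≤ (‖K‖ * ‖x‖) * ‖x‖ :=
            mul_le_mul_of_nonneg_right (K.le_opNorm x) (norm_nonneg _)
        _ = _ := by ring
    rw [abs_mul, abs_of_pos hε]
    calc ε * |(⟪K x, x⟫_ℂ).re| ≤ ε * (‖K‖ * ‖x‖ ^ 2) := mul_le_mul_of_nonneg_left h1 hε.le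
      _ = (ε * ‖K‖) * ‖x‖ ^ 2 := by ring
      _ ≤ _ := mul_le_mul_of_nonneg_right (by linarith) (by positivity)
  refine exists_lyapunov_solution (Q := 1 + (ε : ℂ) • K) (b := 1 / 2) (c := 3 / 2) (r := ε * α)
    (m := 2 / α) ?_ (by norm_num) ?_ ?_ (by norm_num) (by positivity) hε (by positivity) ?_ ?_
  · exact (IsSelfAdjoint.one _).add (IsSelfAdjoint.smul (by simp [isSelfAdjoint_iff]) hK)
  · intro x
    rw [hQin]
    linarith [neg_le_of_abs_le (hKb x)]
  · intro x
    rw [hQin]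
    linarith [le_of_abs_le (hKb x)]
  · have : 2 / α * (ε * α) = 2 * ε := by field_simp
    linarith
  · intro x
    refine (hQA ε hε x).trans (neg_le_neg (mul_le_mul_of_nonneg_right ?_ (by positivity)))
    have : ε * α ≤ ε * (2 * (α - ε * (‖K‖ * ‖M‖))) :=
      mul_le_mul_of_nonneg_left (by linarith) hε.le
    linarith

end Perturbation

/-! ### Spectral decomposition of the controller -/

section Controller

variable {p q : ℕ}

theorem Jc_apply_inl (ω : Fin (q + 1) → ℝ) (x : Xc p q) (i : Fin p) :
    Jc p ω x (Sum.inl i) = 0 := by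
  simp [Jc, JcMat, Matrix.toLpLin_apply, Matrix.mulVec, dotProduct]

theorem Jc_apply_inr_inl (ω : Fin (q + 1) → ℝ) (x : Xc p q) (i : Fin p) (k : Fin q) :
    Jc p ω x (Sum.inr (Sum.inl i, k)) = (ω k.succ : ℂ) * x (Sum.inr (Sum.inr i, k)) := by
  simp [Jc, JcMat, JcBlock, Matrix.toLpLin_apply, Matrix.mulVec, dotProduct,
    Fintype.sum_prod_type, Matrix.blockDiagonal_apply, Matrix.one_apply, Finset.sum_ite_eq]

theorem Jc_apply_inr_inr (ω : Fin (q + 1) → ℝ) (x : Xc p q) (i : Fin p) (k : Fin q) :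
    Jc p ω x (Sum.inr (Sum.inr i, k)) = -((ω k.succ : ℂ) * x (Sum.inr (Sum.inl i, k))) := by
  simp [Jc, JcMat, JcBlock, Matrix.toLpLin_apply, Matrix.mulVec, dotProduct,
    Fintype.sum_prod_type, Matrix.blockDiagonal_apply, Matrix.one_apply, Finset.sum_ite_eq]

theorem star_Jc (ω : Fin (q + 1) → ℝ) : star (Jc p ω) = -Jc p ω := by
  rw [ContinuousLinearMap.star_eq_adjoint, eq_comm, ContinuousLinearMap.eq_adjoint_iff]
  intro x y
  simp only [PiLp.inner_apply, neg_apply, Fintype.sum_sum_type, Fintype.sum_prod_type,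
    PiLp.neg_apply, Jc_apply_inl, Jc_apply_inr_inl, Jc_apply_inr_inr]
  simp [mul_comm, mul_assoc, mul_left_comm, add_comm]

theorem adjoint_Bc_apply (x : Xc p q) (i : Fin p) :
    ContinuousLinearMap.adjoint (Bc p q) x i =
      x (Sum.inl i) + ∑ k : Fin q, x (Sum.inr (Sum.inl i, k)) := by
  have h : ContinuousLinearMap.adjoint (Bc p q) =
      LinearMap.toContinuousLinearMap (Matrix.toEuclideanLin (BcMat p q).conjTranspose) := by
    rw [Matrix.toEuclideanLin_conjTranspose_eq_adjoint]
    rfl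
  rw [h]
  simp [BcMat, Matrix.toLpLin_apply, Matrix.mulVec, dotProduct,
    Fintype.sum_prod_type, Matrix.one_apply, Finset.sum_comm]

/-- The spectral modes of `J_c`: the zero mode and the modes `± i ω_k`. -/
abbrev Mode (q : ℕ) : Type := Option (Fin q × Bool)

/-- The sign of a nonzero mode. -/
def modeSign : Bool → ℝ
  | true => 1
  | false => -1

theorem modeSign_mul_self (b : Bool) : (modeSign b : ℂ) * modeSign b = 1 := by
  cases b <;> simp [modeSign]

/-- The frequency of a mode. -/
def modeFreq (ω : Fin (q + 1) → ℝ) : Mode q → ℝ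
  | none => 0
  | some (k, b) => modeSign b * ω k.succ

/-- Distinctness of the frequencies keeps the denominators in the averaging operator `K` nonzero. -/
theorem modeFreq_injective {ω : Fin (q + 1) → ℝ} (hω0 : ω 0 = 0) (hω : StrictMono ω) :
    Function.Injective (modeFreq ω) := by
  have hpos : ∀ k : Fin q, 0 < ω k.succ := fun k => by
    rw [← hω0]; exact hω (Fin.succ_pos k)
  rintro (_ | ⟨k, b⟩) (_ | ⟨l, c⟩) h
  · rfl
  · have := hpos l
    cases c <;> simp [modeFreq, modeSign] at h <;> linarith
  · have := hpos k
    cases b <;> simp [modeFreq, modeSign] at h <;> linarith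
  · have h1 := hpos k
    have h2 := hpos l
    cases b <;> cases c <;> simp [modeFreq, modeSign, hω.injective.eq_iff] at h ⊢ <;>
      first | exact h | linarith

/-- The eigenvectors of `J_c` belonging to a mode, parametrised by `ℂ^p`. -/
noncomputable def modeVec : Mode q → EuclideanSpace ℂ (Fin p) →ₗ[ℂ] Xc p q
  | none =>
    { toFun := fun u => WithLp.toLp 2 (Sum.elim u (fun _ => 0))
      map_add' := fun u v => by ext (i | ⟨i | i, l⟩) <;> simp
      map_smul' := fun c u => by ext (i | ⟨i | i, l⟩) <;> simp }
  | some (k, b) =>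
    { toFun := fun u => WithLp.toLp 2 (Sum.elim (fun _ => 0) (fun il =>
        if il.2 = k then Sum.elim (fun i => u i) (fun i => modeSign b * Complex.I * u i) il.1
        else 0))
      map_add' := fun u v => by
        ext (i | ⟨i | i, l⟩)
        · simp
        · by_cases h : l = k <;> simp [h]
        · by_cases h : l = k <;> simp [h, mul_add]
      map_smul' := fun c u => by
        ext (i | ⟨i | i, l⟩)
        · simp
        · by_cases h : l = k <;> simp [h]
        · by_cases h : l = k <;> simp [h, mul_left_comm] }

/-- The coordinates of a controller state along the eigenvectors of a mode. -/
noncomputable def modeCoord : Mode q → Xc p q →ₗ[ℂ] EuclideanSpace ℂ (Fin p)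
  | none =>
    { toFun := fun x => WithLp.toLp 2 (fun i => x (Sum.inl i))
      map_add' := fun x y => by ext i; simp
      map_smul' := fun c x => by ext i; simp }
  | some (k, b) =>
    { toFun := fun x => WithLp.toLp 2 (fun i => (1 / 2 : ℂ) *
        (x (Sum.inr (Sum.inl i, k)) - modeSign b * Complex.I * x (Sum.inr (Sum.inr i, k))))
      map_add' := fun x y => by ext i; simp; ring
      map_smul' := fun c x => by ext i; simp; ring }

theorem modeVec_none_inl (u : EuclideanSpace ℂ (Fin p)) (i : Fin p) :
    modeVec (q := q) none u (Sum.inl i) = u i := rfl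

theorem modeVec_none_inr (u : EuclideanSpace ℂ (Fin p)) (il : (Fin p ⊕ Fin p) × Fin q) :
    modeVec (q := q) none u (Sum.inr il) = 0 := rfl

theorem modeVec_some_inl (k : Fin q) (b : Bool) (u : EuclideanSpace ℂ (Fin p)) (i : Fin p) :
    modeVec (some (k, b)) u (Sum.inl i) = 0 := rfl

theorem modeVec_some_inr_inl (k : Fin q) (b : Bool) (u : EuclideanSpace ℂ (Fin p)) (i : Fin p)
    (l : Fin q) :
    modeVec (some (k, b)) u (Sum.inr (Sum.inl i, l)) = if l = k then u i else 0 := rfl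

theorem modeVec_some_inr_inr (k : Fin q) (b : Bool) (u : EuclideanSpace ℂ (Fin p)) (i : Fin p)
    (l : Fin q) :
    modeVec (some (k, b)) u (Sum.inr (Sum.inr i, l)) =
      if l = k then modeSign b * Complex.I * u i else 0 := rfl

theorem modeCoord_none (x : Xc p q) (i : Fin p) : modeCoord none x i = x (Sum.inl i) := rfl

theorem modeCoord_some (k : Fin q) (b : Bool) (x : Xc p q) (i : Fin p) :
    modeCoord (some (k, b)) x i = (1 / 2 : ℂ) *
      (x (Sum.inr (Sum.inl i, k)) - modeSign b * Complex.I * x (Sum.inr (Sum.inr i, k))) := rfl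

theorem Jc_modeVec (ω : Fin (q + 1) → ℝ) (j : Mode q) (u : EuclideanSpace ℂ (Fin p)) :
    Jc p ω (modeVec j u) = (Complex.I * (modeFreq ω j : ℂ)) • modeVec j u := by
  ext (i | ⟨i | i, l⟩) <;> rcases j with _ | ⟨k, b⟩ <;>
    simp only [Jc_apply_inl, Jc_apply_inr_inl, Jc_apply_inr_inr, PiLp.smul_apply, smul_eq_mul,
      modeVec_none_inl, modeVec_none_inr, modeVec_some_inl, modeVec_some_inr_inl,
      modeVec_some_inr_inr, modeFreq] <;>
    try simp
  · split_ifs with h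
    · subst h; ring
    · rfl
  · split_ifs with h
    · subst h
      linear_combination ((ω l.succ : ℂ) * u i) * modeSign_mul_self b -
        ((ω l.succ : ℂ) * u i * modeSign b * modeSign b) * Complex.I_sq
    · simp

theorem modeCoord_modeVec_self (j : Mode q) (u : EuclideanSpace ℂ (Fin p)) :
    modeCoord j (modeVec j u) = u := by
  ext i
  rcases j with _ | ⟨k, b⟩
  · rfl
  · simp only [modeCoord_some, modeVec_some_inr_inl, modeVec_some_inr_inr, if_true]
    linear_combination (1 / 2 * u i) * modeSign_mul_self b -
      (1 / 2 * u i * modeSign b * modeSign b) * Complex.I_sq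

theorem modeCoord_modeVec_of_ne {j j' : Mode q} (h : j ≠ j') (u : EuclideanSpace ℂ (Fin p)) :
    modeCoord j (modeVec j' u) = 0 := by
  ext i
  rcases j with _ | ⟨k, b⟩ <;> rcases j' with _ | ⟨l, c⟩
  · exact absurd rfl h
  · simp [modeCoord_none, modeVec_some_inl]
  · simp [modeCoord_some, modeVec_none_inr]
  · simp only [modeCoord_some, modeVec_some_inr_inl, modeVec_some_inr_inr, PiLp.zero_apply]
    split_ifs with hk
    · subst hk
      cases b <;> cases c <;> simp [modeSign] at h ⊢ <;>
        linear_combination u i * Complex.I_sq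
    · simp

theorem sum_modeVec_modeCoord (x : Xc p q) : ∑ j, modeVec j (modeCoord j x) = x := by
  ext (i | ⟨i | i, l⟩) <;> rw [WithLp.ofLp_sum, Finset.sum_apply] <;>
    simp only [Fintype.sum_option, Fintype.sum_prod_type,
      Fintype.sum_bool, modeVec_none_inl, modeVec_none_inr, modeVec_some_inl,
      modeVec_some_inr_inl, modeVec_some_inr_inr, modeCoord_none, modeCoord_some, modeSign]
  · simp
  · rw [Finset.sum_eq_single l]
    · simp
      ring
    · intro k _ hk
      simp [hk.symm]
    · simp
  · rw [Finset.sum_eq_single l]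
    · simp
      linear_combination (-x (Sum.inr (Sum.inr i, l))) * Complex.I_sq
    · intro k _ hk
      simp [hk.symm]
    · simp

theorem sum_modeCoord (x : Xc p q) :
    ∑ j, modeCoord j x = ContinuousLinearMap.adjoint (Bc p q) x := by
  ext i
  rw [adjoint_Bc_apply, WithLp.ofLp_sum, Finset.sum_apply]
  simp only [Fintype.sum_option, Fintype.sum_prod_type,
    Fintype.sum_bool, modeCoord_none, modeCoord_some, modeSign]
  congr 1
  refine Finset.sum_congr rfl fun k _ => ?_
  push_cast
  ring

/-- The squared length of the eigenvectors of a mode. -/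
def modeWeight : Mode q → ℝ
  | none => 1
  | some _ => 2

theorem modeWeight_pos (j : Mode q) : 0 < modeWeight j := by
  cases j <;> simp [modeWeight]

/-- Up to the weight, `modeCoord j` is the adjoint of `modeVec j`. This makes the spectral
projections orthogonal and fixes the length of the eigenvectors. -/
theorem inner_modeVec (j : Mode q) (x : Xc p q) (u : EuclideanSpace ℂ (Fin p)) :
    ⟪x, modeVec j u⟫_ℂ = modeWeight j * ⟪modeCoord j x, u⟫_ℂ := by
  rcases j with _ | ⟨k, b⟩
  · simp [PiLp.inner_apply, modeVec_none_inl, modeVec_none_inr, modeCoord_none, modeWeight]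
  · simp only [PiLp.inner_apply, Fintype.sum_sum_type, Fintype.sum_prod_type, modeVec_some_inl,
      modeVec_some_inr_inl, modeVec_some_inr_inr, modeCoord_some, modeWeight, Finset.mul_sum]
    have h2 : (starRingEnd ℂ) 2 = 2 := map_ofNat _ 2
    simp [← Finset.sum_add_distrib, h2]
    refine Finset.sum_congr rfl fun i _ => ?_
    ring

theorem modeCoord_Jc (ω : Fin (q + 1) → ℝ) (j : Mode q) (x : Xc p q) :
    modeCoord j (Jc p ω x) = (Complex.I * (modeFreq ω j : ℂ)) • modeCoord j x := by
  conv_lhs => rw [← sum_modeVec_modeCoord x]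
  rw [map_sum, map_sum, Finset.sum_eq_single j]
  · rw [Jc_modeVec, map_smul, modeCoord_modeVec_self]
  · intro k _ hk
    rw [Jc_modeVec, map_smul, modeCoord_modeVec_of_ne hk.symm, smul_zero]
  · simp

/-- The spectral projection of `J_c` onto a mode. -/
noncomputable def modeProj (j : Mode q) : Xc p q →L[ℂ] Xc p q :=
  LinearMap.toContinuousLinearMap (modeVec j ∘ₗ modeCoord j)

theorem modeProj_apply (j : Mode q) (x : Xc p q) :
    modeProj j x = modeVec j (modeCoord j x) := rfl

theorem isSelfAdjoint_modeProj (j : Mode q) : IsSelfAdjoint (modeProj (p := p) j) := by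
  rw [ContinuousLinearMap.isSelfAdjoint_iff_isSymmetric]
  intro x y
  change ⟪modeVec j (modeCoord j x), y⟫_ℂ = ⟪x, modeVec j (modeCoord j y)⟫_ℂ
  rw [inner_modeVec, ← inner_conj_symm, inner_modeVec, map_mul, Complex.conj_ofReal,
    inner_conj_symm]

theorem modeProj_mul_self (j : Mode q) : modeProj (p := p) j * modeProj j = modeProj j := by
  ext1 x
  change modeVec j (modeCoord j (modeVec j (modeCoord j x))) = _
  rw [modeCoord_modeVec_self, modeProj_apply]

theorem sum_modeProj : ∑ j : Mode q, modeProj (p := p) j = 1 := by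
  ext1 x
  rw [sum_apply]
  exact sum_modeVec_modeCoord x

theorem Jc_mul_modeProj (ω : Fin (q + 1) → ℝ) (j : Mode q) :
    Jc p ω * modeProj j = (Complex.I * (modeFreq ω j : ℂ)) • modeProj j := by
  ext1 x
  exact Jc_modeVec ω j _

theorem norm_modeVec_sq (j : Mode q) (u : EuclideanSpace ℂ (Fin p)) :
    ‖modeVec j u‖ ^ 2 = modeWeight j * ‖u‖ ^ 2 := by
  have h := congrArg Complex.re (inner_modeVec j (modeVec j u) u)
  rw [modeCoord_modeVec_self, Complex.re_ofReal_mul] at h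
  have h1 : ∀ v : Xc p q, (⟪v, v⟫_ℂ).re = ‖v‖ ^ 2 := fun v => inner_self_eq_norm_sq (𝕜 := ℂ) v
  have h2 : (⟪u, u⟫_ℂ).re = ‖u‖ ^ 2 := inner_self_eq_norm_sq (𝕜 := ℂ) u
  rwa [h1, h2] at h

/-- The eigenvectors `(u, ±iu)` are normalised by their first component, the one that `Bc*` reads.
This turns the form of `Bc ∘L CH` on a mode into that of the transfer function. -/
theorem adjoint_Bc_modeVec (j : Mode q) (u : EuclideanSpace ℂ (Fin p)) :
    ContinuousLinearMap.adjoint (Bc p q) (modeVec j u) = u := by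
  rw [← sum_modeCoord, Finset.sum_eq_single j]
  · exact modeCoord_modeVec_self j u
  · exact fun k _ hk => modeCoord_modeVec_of_ne hk u
  · simp

end Controller

/-! ### The solution of the regulator equations -/

section Regulator

variable {X Z : Type*} [NormedAddCommGroup X] [InnerProductSpace ℂ X]
  [NormedAddCommGroup Z] [InnerProductSpace ℂ Z] {p n1 n3 q : ℕ}

theorem re_inner_of_opPos_opRe {E : Type*} [NormedAddCommGroup E] [InnerProductSpace ℂ E]
    [CompleteSpace E] {T : E →L[ℂ] E} (h : OpPos (opRe T)) :
    ∃ ε : ℝ, 0 < ε ∧ ∀ x, ε * ‖x‖ ^ 2 ≤ (⟪x, T x⟫_ℂ).re := by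
  obtain ⟨ε, hε, hpos⟩ := h
  refine ⟨ε, hε, fun x => ?_⟩
  have h1 := hpos.re_inner_nonneg_left x
  change 0 ≤ (⟪(opRe T - (ε : ℂ) • ContinuousLinearMap.id ℂ E) x, x⟫_ℂ).re at h1
  have h2 : (⟪x, x⟫_ℂ).re = ‖x‖ ^ 2 := inner_self_eq_norm_sq (𝕜 := ℂ) x
  have h3 : (⟪T x, x⟫_ℂ).re = (⟪x, T x⟫_ℂ).re := inner_re_symm (𝕜 := ℂ) _ _
  have h4 : (⟪opRe T x, x⟫_ℂ).re = (⟪x, T x⟫_ℂ).re := by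
    have h5 : (1 / 2 : ℂ) = ((1 / 2 : ℝ) : ℂ) := by norm_num
    rw [opRe, h5, smul_apply, add_apply, inner_smul_left, Complex.conj_ofReal,
      Complex.re_ofReal_mul, inner_add_left, Complex.add_re,
      ContinuousLinearMap.adjoint_inner_left, h3]
    ring
  rw [re_inner_sub_smul, ContinuousLinearMap.id_apply, h2, h4] at h1
  linarith

namespace BCSData

/-- The solution operator `u ↦ z` of `(lam - 𝔄) z = 0`, `𝔅 z = u`. -/
noncomputable def boundarySolution {sys : BCSData X Z p n1 n3} (hsys : sys.IsBCS) {lam : ℂ}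
    (hl : lam ∈ resolventSet sys.A) : EuclideanSpace ℂ (Fin p) →ₗ[ℂ] Z :=
  (sys.eigenspace lam).subtype ∘ₗ
    (LinearEquiv.ofBijective (sys.traceMap lam) (traceMap_bijective hsys hl)).symm.toLinearMap

variable {sys : BCSData X Z p n1 n3} (hsys : sys.IsBCS) {lam : ℂ}
  (hl : lam ∈ resolventSet sys.A) (u : EuclideanSpace ℂ (Fin p))

theorem Bd_boundarySolution : sys.Bd (boundarySolution hsys hl u) = 0 :=
  (((LinearEquiv.ofBijective (sys.traceMap lam)
    (traceMap_bijective hsys hl)).symm u).2).1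

theorem A0_boundarySolution :
    sys.A0 (boundarySolution hsys hl u) = lam • sys.emb (boundarySolution hsys hl u) :=
  (sub_eq_zero.1 (((LinearEquiv.ofBijective (sys.traceMap lam)
    (traceMap_bijective hsys hl)).symm u).2).2).symm

theorem B_boundarySolution : sys.B (boundarySolution hsys hl u) = u :=
  (LinearEquiv.ofBijective (sys.traceMap lam) (traceMap_bijective hsys hl)).apply_symm_apply u

theorem C_boundarySolution :
    sys.C (boundarySolution hsys hl u) = transferFunction hsys lam hl u := rfl

theorem intoZ_eq {V : Type*} [NormedAddCommGroup V] [InnerProductSpace ℂ V] (H : V →L[ℂ] X)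
    (hH : ∀ v, H v ∈ LinearMap.range sys.emb) {v : V} {z : Z} (hz : sys.emb z = H v) :
    sys.intoZ H hH v = z := by
  change sys.toRange.symm ⟨H v, hH v⟩ = z
  rw [LinearEquiv.symm_apply_eq]
  exact Subtype.ext hz.symm

end BCSData

end Regulator

end RobustReg

theorem mainTheorem5
    {X Z : Type*} [NormedAddCommGroup X] [InnerProductSpace ℂ X] [CompleteSpace X]
    [NormedAddCommGroup Z] [InnerProductSpace ℂ Z] [CompleteSpace Z]
    {p n1 n3 q : ℕ} (sys : RobustReg.BCSData X Z p n1 n3) (hsys : sys.IsBCS)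
    (ω : Fin (q + 1) → ℝ) (hω0 : ω 0 = 0) (hω : StrictMono ω)
    (hP : RobustReg.BCSData.FreqPositive hsys ω) (hstab : sys.IsExpStable) :
    ∃ (H : RobustReg.Xc p q →L[ℂ] X) (hH : ∀ v, H v ∈ LinearMap.range sys.emb),
      (∀ v, ∃ hv : H v ∈ sys.frakA.domain,
        H (RobustReg.Jc p ω v) = sys.frakA ⟨H v, hv⟩) ∧
      (∀ v, sys.B (sys.intoZ H hH v) =
        -(ContinuousLinearMap.adjoint (RobustReg.Bc p q) v)) ∧
      ∃ CH : RobustReg.Xc p q →L[ℂ] EuclideanSpace ℂ (Fin p),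
        (∀ v, CH v = sys.C (sys.intoZ H hH v)) ∧
        ∃ δ₀ Mc : ℝ, 0 < δ₀ ∧ 0 < Mc ∧ ∀ δ : ℝ, 0 < δ → δ < δ₀ →
          ∃ Pc0 : RobustReg.Xc p q →L[ℂ] RobustReg.Xc p q,
            RobustReg.OpPos Pc0 ∧ ‖Pc0‖ ≤ Mc ∧
            Pc0 ∘L (RobustReg.Jc p ω + ((δ : ℂ) ^ 2) • (RobustReg.Bc p q ∘L CH)) +
              ContinuousLinearMap.adjoint
                (RobustReg.Jc p ω + ((δ : ℂ) ^ 2) • (RobustReg.Bc p q ∘L CH)) ∘L Pc0 =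
              -(((δ : ℂ) ^ 2) • ContinuousLinearMap.id ℂ (RobustReg.Xc p q)) := by
  have hmode : ∀ j : RobustReg.Mode q,
      ∃ hl : Complex.I * (RobustReg.modeFreq ω j : ℂ) ∈ RobustReg.resolventSet sys.A,
        RobustReg.OpPos (RobustReg.opRe (RobustReg.BCSData.transferFunction hsys _ hl)) := by
    rintro (_ | ⟨k, _ | _⟩)
    · exact hP 0 _ (Or.inl (by rw [hω0]; rfl))
    · exact hP k.succ _ (Or.inr (by simp [RobustReg.modeFreq, RobustReg.modeSign]))
    · exact hP k.succ _ (Or.inl (by simp [RobustReg.modeFreq, RobustReg.modeSign]))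
  choose hl hpos using hmode
  choose a ha hla using fun j => RobustReg.re_inner_of_opPos_opRe (hpos j)
  -- The minus sign gives `𝔅H = -Bc*` and also makes the feedback `Bc ∘L CH` dissipative on each
  -- mode.
  set Hz : RobustReg.Xc p q →ₗ[ℂ] Z :=
    -∑ j, RobustReg.BCSData.boundarySolution hsys (hl j) ∘ₗ RobustReg.modeCoord j with hHz
  have hHz_apply : ∀ v, Hz v =
      -∑ j, RobustReg.BCSData.boundarySolution hsys (hl j) (RobustReg.modeCoord j v) := fun v => by
    simp [hHz]
  have hHz_mode : ∀ j u, Hz (RobustReg.modeVec j u) =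
      -RobustReg.BCSData.boundarySolution hsys (hl j) u := fun j u => by
    rw [hHz_apply, Finset.sum_eq_single j, RobustReg.modeCoord_modeVec_self]
    · intro k _ hk
      rw [RobustReg.modeCoord_modeVec_of_ne hk, map_zero]
    · simp
  have hBd : ∀ v, sys.Bd (Hz v) = 0 := fun v => by
    rw [hHz_apply, map_neg, map_sum]
    simp [RobustReg.BCSData.Bd_boundarySolution]
  have hA0 : ∀ v, sys.A0 (Hz v) = sys.emb (Hz (RobustReg.Jc p ω v)) := fun v => by
    rw [hHz_apply, hHz_apply]
    simp only [map_neg, map_sum, RobustReg.BCSData.A0_boundarySolution, RobustReg.modeCoord_Jc,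
      map_smul]
  have hB : ∀ v, sys.B (Hz v) = -(ContinuousLinearMap.adjoint (RobustReg.Bc p q) v) := fun v => by
    rw [hHz_apply, ← RobustReg.sum_modeCoord]
    simp only [map_neg, map_sum, RobustReg.BCSData.B_boundarySolution]
  set H : RobustReg.Xc p q →L[ℂ] X := LinearMap.toContinuousLinearMap (sys.emb ∘ₗ Hz) with hHdef
  have hH : ∀ v, H v ∈ LinearMap.range sys.emb := fun v => ⟨Hz v, rfl⟩
  have hinto : ∀ v, sys.intoZ H hH v = Hz v := fun v => RobustReg.BCSData.intoZ_eq H hH rfl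
  set CH : RobustReg.Xc p q →L[ℂ] EuclideanSpace ℂ (Fin p) := LinearMap.toContinuousLinearMap
    ((sys.C : Z →ₗ[ℂ] EuclideanSpace ℂ (Fin p)) ∘ₗ Hz) with hCHdef
  have hCH : ∀ v, CH v = sys.C (Hz v) := fun v => rfl
  refine ⟨H, hH, fun v => ?_, fun v => by rw [hinto, hB], CH, fun v => by rw [hinto, hCH], ?_⟩
  · have hmem : Hz v ∈ LinearMap.ker (sys.Bd : Z →ₗ[ℂ] EuclideanSpace ℂ (Fin n3)) := hBd v
    refine ⟨Submodule.mem_map_of_mem hmem, ?_⟩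
    refine Eq.trans ?_ (sys.restrict_apply _ (Hz v) hmem (Submodule.mem_map_of_mem hmem)).symm
    exact (hA0 v).symm
  -- The worst mode supplies a single `α`; the weight converts `‖u‖²` into `‖modeVec j u‖²`.
  · obtain ⟨j0, hj0⟩ := Finite.exists_min fun j => a j / RobustReg.modeWeight j
    obtain ⟨ε₀, Mc, hε₀, hMc, hsol⟩ :=
      RobustReg.exists_lyapunov_solution_of_small_perturbation (M := RobustReg.Bc p q ∘L CH)
        (RobustReg.modeFreq_injective hω0 hω) RobustReg.isSelfAdjoint_modeProj
        RobustReg.modeProj_mul_self RobustReg.sum_modeProj (RobustReg.star_Jc ω)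
        (RobustReg.Jc_mul_modeProj ω) (div_pos (ha j0) (RobustReg.modeWeight_pos j0)) (by
          intro j x
          -- Moving `Bc` across the inner product reduces the form on mode `j` to `-Re⟪u, P(iθ_j)
          -- u⟫` with `u = modeCoord j x`.
          rw [RobustReg.modeProj_apply, RobustReg.norm_modeVec_sq, ContinuousLinearMap.comp_apply,
            ← ContinuousLinearMap.adjoint_inner_left, RobustReg.adjoint_Bc_modeVec, hCH, hHz_mode,
            map_neg, inner_neg_right, Complex.neg_re, RobustReg.BCSData.C_boundarySolution]
          have hw := RobustReg.modeWeight_pos j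
          have h1 := (le_div_iff₀ hw).1 (hj0 j)
          rw [← mul_assoc]
          exact neg_le_neg ((mul_le_mul_of_nonneg_right h1 (by positivity)).trans (hla j _)))
    -- The perturbation parameter is `ε = δ²`, so the threshold for `δ` is a square root.
    refine ⟨Real.sqrt ε₀, Mc, Real.sqrt_pos.2 hε₀, hMc, fun δ hδ hlt => ?_⟩
    have := hsol (δ ^ 2) (by positivity) ((Real.lt_sqrt hδ.le).1 hlt)
    rwa [Complex.ofReal_pow] at this
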